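/- **Setting.** Let $A=(a_{ij})_{i,j\in I}$, $I=\{1,\dots,n\}$, be a symmetrizable generalized Cartan matrix with symmetrizer $D=\mathrm{diag}(r_1,\dots,r_n)$, $r_i\in\mathbb Z_{>0}$, put $b_{ij}=r_ia_{ij}$, and let $(\mathfrak h,\{\alpha_i\},\{\alpha_i^\vee\})$ be a realization of $A$ with $\dim\mathfrak h=2n-\mathrm{rank}\,A$. Over $\mathbb C(v)$ put $v_i=v^{r_i}$ and $[l]_v=\frac{v^{-l}-v^l}{v^{-1}-v}$ ($l\in\mathbb Z$). The quantum loop algebra $U_v(\mathcal L\mathfrak g)$ is the $\mathbb C(v)$-algebra generated by $E_{i,l},F_{i,l}$ ($i\in I$, $l\in\mathbb Z$), $H_{i,s}$ ($i\in I$, $s\in\mathbb Z\setminus\{0\}$) and $K_h$ ($h\in\mathfrak h$ with $\alpha_j(h)\in\mathbb Z$ for all $j$) with the relations $$K_hK_{h'}=K_{h+h'},\quad K_0=1,\quad [K_h,H_{j,s}]=[H_{i,s},H_{j,t}]=0,$$ $$K_hE_{j,l}K_{-h}=v^{-\alpha_j(h)}E_{j,l},\quad K_hF_{j,l}K_{-h}=v^{\alpha_j(h)}F_{j,l},$$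 $$[H_{i,s},E_{j,l}]=\tfrac{[sb_{ij}]_v}{s}E_{j,s+l},\quad [H_{i,s},F_{j,l}]=-\tfrac{[sb_{ij}]_v}{s}F_{j,s+l},\quad [E_{i,l},F_{j,m}]=\delta_{ij}\frac{\phi^+_{i,l+m}-\phi^-_{i,l+m}}{v_i^{-1}-v_i},$$ $$v^{b_{ij}}E_{i,l+1}E_{j,m}-E_{j,m}E_{i,l+1}=E_{i,l}E_{j,m+1}-v^{b_{ij}}E_{j,m+1}E_{i,l},$$ $$v^{-b_{ij}}F_{i,l+1}F_{j,m}-F_{j,m}F_{i,l+1}=F_{i,l}F_{j,m+1}-v^{-b_{ij}}F_{j,m+1}F_{i,l},$$ and, for $i\ne j$, $r=1-a_{ij}$ and all $l_1,\dots,l_r,l'\in\mathbb Z$, $$\sum_{\sigma\in\mathfrak S_r}\sum_{k=0}^r(-1)^k\begin{bmatrix}r\\k\end{bmatrix}_{v_i}E_{i,l_{\sigma(1)}}\cdots E_{i,l_{\sigma(k)}}E_{j,l'}E_{i,l_{\sigma(k+1)}}\cdots E_{i,l_{\sigma(r)}}=0,$$ together with the same relation for the $F$'s. Here $\sum_{s\ge0}\phi^\pm_{i,\pm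 s}z^{\pm s}=K_{\pm r_i\alpha_i^\vee}\exp\big(\pm(v^{-1}-v)\sum_{s\ge1}H_{i,\pm s}z^{\pm s}\big)$ and $\phi^{\pm}_{i,\pm s}=0$ for $s<0$. Put $\sum_{s\ge0}\theta^+_{i,s}z^s=\exp\big((v^{-1}-v)\sum_{s\ge1}H_{i,s}z^s\big)$. Let $U_v^+(\mathcal L\mathfrak g)$ be the subalgebra generated by all $E_{i,l}$ and all $H_{i,s}$ with $s\ge1$, and $U_v(\mathcal L\mathfrak n)$ the subalgebra generated by all $E_{i,l}$. Give $E_{i,l}$ the weight $\alpha_i$ and $H_{i,s}$ the weight $0$, and put $(\alpha_i,\alpha_j)=b_{ij}$. On the completed tensor square use the product $(x_1\otimes x_2)(y_1\otimes y_2)=v^{-(\mathrm{wt}\,x_2,\mathrm{wt}\,y_1)}x_1y_1\otimes x_2y_2$. Let $\Delta'$ be the algebra homomorphism with $$\Delta'(E_{i,l})=E_{i,l}\otimes1+\sum_{t\ge0}\theta^+_{i,t}\otimes E_{i,l-t},\qquad \Delta'(\theta^+_{i,m})=\sum_{0\le t\le m}\theta^+_{i,m-t}\otimes\theta^+_{i,t}$$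 (the second condition says that all $H_{i,s}$, $s\ge1$, are primitive), and let $(\ ,\ )$ be the symmetric Hopf pairing, $(x,yz)=(\Delta'(x),y\otimes z)$, with $$(E_{i,k},E_{j,l})=\frac{\delta_{ij}\delta_{kl}}{v^{-2}-1},\qquad (H_{i,s},H_{j,t})=\delta_{st}\frac{[sb_{ij}]_v}{s(v^{-1}-v)},\qquad (E_{i,k},H_{j,s})=0 .$$ For $i\in I$, $m\in\mathbb Z$ put $F'_{i,m}(x)=\sum(v^{-2}-1)(E_{i,m},x_{(1)})\,x_{(2)}$, where $\Delta'(x)=\sum x_{(1)}\otimes x_{(2)}$. No well-definedness modulo the relations is presupposed: $\Delta'$, $(\ ,\ )$ and $F'_{i,m}$ are computed on the free algebra on the generators $E_{i,l}$ ($l\in\mathbb Z$), $H_{i,s}$ ($s\ge1$), and $\pi$ denotes the canonical homomorphism from this free algebra onto $U_v^+(\mathcal L\mathfrak g)$. Let $T_E$ be the free subalgebra on the $E_{i,l}$, so that $\pi(T_E)=U_v(\mathcal L\mathfrak n)$. **Statement.** Let $i\in I$ and $k\in\mathbb Z$. 1. The common kernel $$Z'_{i,k}=\{\pi(x)\;:\;x\in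 T_E,\ \pi(F'_{i,m}(x))=0\text{ for all }m\le k\}$$ is a (unital) subalgebra of $U_v(\mathcal L\mathfrak n)$. 2. If $(F'_{i,m})_{m\in\mathbb Z}$ are linear operators on $U_v(\mathcal L\mathfrak n)$ given by the formula above, that is, $F'_{i,m}(\pi(x))=\pi(F'_{i,m}(x))$ for all $x\in T_E$ and $m\in\mathbb Z$, then $\bigcap_{m\le k}\ker F'_{i,m}$ is a (unital) subalgebra of $U_v(\mathcal L\mathfrak n)$. -/

import Mathlib

noncomputable section

namespace QLoop

open scoped BigOperators

/-! ### The ground field `ℂ(v)` and quantum integers -/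

/-- The field `ℂ(v)`. -/
abbrev Kv : Type := RatFunc ℂ

/-- The indeterminate `v`. -/
def v : Kv := RatFunc.X

/-- The quantum integer `[l]_x = (x^{-l} - x^l) / (x^{-1} - x)`, for any integer `l`. -/
def qInt (x : Kv) (l : ℤ) : Kv := (x ^ (-l) - x ^ l) / (x⁻¹ - x)

/-- `[l]_x! = [l]_x [l-1]_x ⋯ [1]_x`. -/
def qFact (x : Kv) (l : ℕ) : Kv := ∏ s ∈ Finset.range l, qInt x (s + 1)

/-- The Gaussian binomial coefficient. -/
def qBinom (x : Kv) (r k : ℕ) : Kv := qFact x r / (qFact x k * qFact x (r - k))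

/-- The coefficient of `z^m` in `exp (c ∑_{s ≥ 1} a_s z^s)`, for elements `a_s` of an algebra.
Since the exponent has no constant term, only the powers up to `m` contribute. -/
def expCoeff {A : Type*} [Ring A] [Algebra Kv A] (c : Kv) (a : ℕ+ → A) (m : ℕ) : A :=
  ∑ k ∈ Finset.range (m + 1), ((k.factorial : Kv)⁻¹) •
    PowerSeries.coeff m
      ((PowerSeries.mk fun s : ℕ => if h : 0 < s then c • a ⟨s, h⟩ else 0) ^ k)

/-! ### Symmetrizable generalized Cartan matrices and their realizations -/

/-- A symmetrizable generalized Cartan matrix `A = (a i j)` with a symmetrizer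
`D = diag (r_1, …, r_n)`. -/
structure CartanDatum (n : ℕ) where
  a : Matrix (Fin n) (Fin n) ℤ
  r : Fin n → ℕ
  diag : ∀ i, a i i = 2
  off_diag : ∀ i j, i ≠ j → a i j ≤ 0
  zero_iff : ∀ i j, a i j = 0 ↔ a j i = 0
  r_pos : ∀ i, 0 < r i
  symm : ∀ i j, (r i : ℤ) * a i j = r j * a j i

/-- The symmetrized matrix `B = D A`; also `b i j = (α_i, α_j)`. -/
def CartanDatum.b {n : ℕ} (C : CartanDatum n) (i j : Fin n) : ℤ := C.r i * C.a i j

/-- A realization `(𝔥, 𝔥^*, Π, Π^∨)` of the Cartan matrix. -/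
structure Realization {n : ℕ} (C : CartanDatum n) (𝔥 : Type*) [AddCommGroup 𝔥] [Module ℂ 𝔥] where
  root : Fin n → Module.Dual ℂ 𝔥
  coroot : Fin n → 𝔥
  finite : FiniteDimensional ℂ 𝔥
  root_indep : LinearIndependent ℂ root
  coroot_indep : LinearIndependent ℂ coroot
  pairing : ∀ i j, root j (coroot i) = (C.a i j : ℂ)
  dim_eq : Module.finrank ℂ 𝔥 + (C.a.map (Int.cast : ℤ → ℂ)).rank = 2 * n

section LoopAlgebra

variable {n : ℕ} {C : CartanDatum n} {𝔥 : Type*} [AddCommGroup 𝔥] [Module ℂ 𝔥]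

/-- The lattice of those `h ∈ 𝔥` on which all simple roots take integral values; these are the
`h` for which `v^{α_j(h)}` makes sense in `ℂ(v)`. -/
def Realization.lattice (ρ : Realization C 𝔥) : AddSubgroup 𝔥 where
  carrier := {h | ∀ j, ∃ m : ℤ, ρ.root j h = m}
  zero_mem' := fun j => ⟨0, by simp⟩
  add_mem' := by
    intro x y hx hy j
    obtain ⟨p, hp⟩ := hx j
    obtain ⟨q, hq⟩ := hy j
    exact ⟨p + q, by simp [hp, hq]⟩
  neg_mem' := by
    intro x hx j
    obtain ⟨p, hp⟩ := hx j
    exact ⟨-p, by simp [hp]⟩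

/-- The element `r_i α_i^∨` of the lattice. -/
def Realization.rcoroot (ρ : Realization C 𝔥) (i : Fin n) : ρ.lattice :=
  ⟨(C.r i : ℂ) • ρ.coroot i, fun j => ⟨C.r i * C.a i j, by simp [ρ.pairing]⟩⟩

/-- The generators `E_{i,l}`, `F_{i,l}`, `K_h`, `H_{i,s}` (`s ≠ 0`) of the quantum loop algebra. -/
inductive Gen (ρ : Realization C 𝔥) : Type _
  | E (i : Fin n) (l : ℤ) : Gen ρ
  | F (i : Fin n) (l : ℤ) : Gen ρ
  | K (h : ρ.lattice) : Gen ρ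
  | H (i : Fin n) (s : {s : ℤ // s ≠ 0}) : Gen ρ

/-- The free `ℂ(v)`-algebra on the generators. -/
abbrev FreeU (ρ : Realization C 𝔥) : Type _ := FreeAlgebra Kv (Gen ρ)

def gE (ρ : Realization C 𝔥) (i : Fin n) (l : ℤ) : FreeU ρ := FreeAlgebra.ι Kv (Gen.E i l)

def gF (ρ : Realization C 𝔥) (i : Fin n) (l : ℤ) : FreeU ρ := FreeAlgebra.ι Kv (Gen.F i l)

def gK (ρ : Realization C 𝔥) (h : ρ.lattice) : FreeU ρ := FreeAlgebra.ι Kv (Gen.K h)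

def gH (ρ : Realization C 𝔥) (i : Fin n) (s : {s : ℤ // s ≠ 0}) : FreeU ρ :=
  FreeAlgebra.ι Kv (Gen.H i s)

/-- The index `s ≥ 1` as a nonzero integer. -/
def posIdx (s : ℕ+) : {s : ℤ // s ≠ 0} := ⟨((s : ℕ) : ℤ), by exact_mod_cast s.ne_zero⟩

/-- The index `-s ≤ -1` as a nonzero integer. -/
def negIdx (s : ℕ+) : {s : ℤ // s ≠ 0} :=
  ⟨-((s : ℕ) : ℤ), neg_ne_zero.mpr (by exact_mod_cast s.ne_zero)⟩

/-- `φ^+_{i,m}`: the coefficient of `z^m` in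
`K_{r_i α_i^∨} exp ((v^{-1} - v) ∑_{s ≥ 1} H_{i,s} z^s)`, and `0` for `m < 0`. -/
def phiPlus (ρ : Realization C 𝔥) (i : Fin n) (m : ℤ) : FreeU ρ :=
  if 0 ≤ m then gK ρ (ρ.rcoroot i) *
    expCoeff (v⁻¹ - v) (fun s => gH ρ i (posIdx s)) m.toNat else 0

/-- `φ^-_{i,m}`: the coefficient of `z^m` in
`K_{-r_i α_i^∨} exp (-(v^{-1} - v) ∑_{s ≥ 1} H_{i,-s} z^{-s})`, and `0` for `m > 0`. -/
def phiMinus (ρ : Realization C 𝔥) (i : Fin n) (m : ℤ) : FreeU ρ :=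
  if m ≤ 0 then gK ρ (-ρ.rcoroot i) *
    expCoeff (-(v⁻¹ - v)) (fun s => gH ρ i (negIdx s)) (-m).toNat else 0

/-- The left-hand side of the loop Serre relation for `x_{i,l_1}, …, x_{i,l_r}` and `y`. -/
def serreSum {A : Type*} [Ring A] [Algebra Kv A] (q : Kv) (r : ℕ) (x : Fin r → A) (y : A) : A :=
  ∑ σ : Equiv.Perm (Fin r), ∑ k ∈ Finset.range (r + 1), ((-1) ^ k * qBinom q r k) •
    (((List.ofFn fun t => x (σ t)).take k).prod * y *
      ((List.ofFn fun t => x (σ t)).drop k).prod)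

/-- The defining relations of the quantum loop algebra. -/
inductive LoopRel (ρ : Realization C 𝔥) : FreeU ρ → FreeU ρ → Prop
  | K_add (h h' : ρ.lattice) : LoopRel ρ (gK ρ h * gK ρ h') (gK ρ (h + h'))
  | K_zero : LoopRel ρ (gK ρ 0) 1
  | K_H (h : ρ.lattice) (j : Fin n) (s : {s : ℤ // s ≠ 0}) :
      LoopRel ρ (gK ρ h * gH ρ j s) (gH ρ j s * gK ρ h)
  | H_H (i j : Fin n) (s t : {s : ℤ // s ≠ 0}) :
      LoopRel ρ (gH ρ i s * gH ρ j t) (gH ρ j t * gH ρ i s)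
  | K_E (h : ρ.lattice) (j : Fin n) (l m : ℤ) (hm : ρ.root j h = m) :
      LoopRel ρ (gK ρ h * gE ρ j l * gK ρ (-h)) (v ^ (-m) • gE ρ j l)
  | K_F (h : ρ.lattice) (j : Fin n) (l m : ℤ) (hm : ρ.root j h = m) :
      LoopRel ρ (gK ρ h * gF ρ j l * gK ρ (-h)) (v ^ m • gF ρ j l)
  | H_E (i j : Fin n) (s : {s : ℤ // s ≠ 0}) (l : ℤ) :
      LoopRel ρ (gH ρ i s * gE ρ j l - gE ρ j l * gH ρ i s)
        ((qInt v (s * C.b i j) / ((s : ℤ) : Kv)) • gE ρ j (s + l))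
  | H_F (i j : Fin n) (s : {s : ℤ // s ≠ 0}) (l : ℤ) :
      LoopRel ρ (gH ρ i s * gF ρ j l - gF ρ j l * gH ρ i s)
        (-(qInt v (s * C.b i j) / ((s : ℤ) : Kv)) • gF ρ j (s + l))
  | E_F (i : Fin n) (l m : ℤ) :
      LoopRel ρ (gE ρ i l * gF ρ i m - gF ρ i m * gE ρ i l)
        (((v ^ C.r i)⁻¹ - v ^ C.r i)⁻¹ • (phiPlus ρ i (l + m) - phiMinus ρ i (l + m)))
  | E_F_ne (i j : Fin n) (hij : i ≠ j) (l m : ℤ) :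
      LoopRel ρ (gE ρ i l * gF ρ j m) (gF ρ j m * gE ρ i l)
  | E_E (i j : Fin n) (l m : ℤ) :
      LoopRel ρ (v ^ C.b i j • (gE ρ i (l + 1) * gE ρ j m) - gE ρ j m * gE ρ i (l + 1))
        (gE ρ i l * gE ρ j (m + 1) - v ^ C.b i j • (gE ρ j (m + 1) * gE ρ i l))
  | F_F (i j : Fin n) (l m : ℤ) :
      LoopRel ρ (v ^ (-C.b i j) • (gF ρ i (l + 1) * gF ρ j m) - gF ρ j m * gF ρ i (l + 1))
        (gF ρ i l * gF ρ j (m + 1) - v ^ (-C.b i j) • (gF ρ j (m + 1) * gF ρ i l))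
  | serre_E (i j : Fin n) (hij : i ≠ j) (l : Fin (1 - C.a i j).toNat → ℤ) (l' : ℤ) :
      LoopRel ρ (serreSum (v ^ C.r i) (1 - C.a i j).toNat (fun t => gE ρ i (l t)) (gE ρ j l')) 0
  | serre_F (i j : Fin n) (hij : i ≠ j) (l : Fin (1 - C.a i j).toNat → ℤ) (l' : ℤ) :
      LoopRel ρ (serreSum (v ^ C.r i) (1 - C.a i j).toNat (fun t => gF ρ i (l t)) (gF ρ j l')) 0

/-- The quantum loop algebra `U_v(L𝔤)`. -/
abbrev LoopAlg (ρ : Realization C 𝔥) : Type _ := RingQuot (LoopRel ρ)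

/-- The element `E_{i,l}` of `U_v(L𝔤)`. -/
def uE (ρ : Realization C 𝔥) (i : Fin n) (l : ℤ) : LoopAlg ρ :=
  RingQuot.mkAlgHom Kv (LoopRel ρ) (gE ρ i l)

/-- The element `H_{i,s}`, `s ≥ 1`, of `U_v(L𝔤)`. -/
def uH (ρ : Realization C 𝔥) (i : Fin n) (s : ℕ+) : LoopAlg ρ :=
  RingQuot.mkAlgHom Kv (LoopRel ρ) (gH ρ i (posIdx s))

/-- `U_v(L𝔫)`: the subalgebra of `U_v(L𝔤)` generated by all `E_{i,l}`. -/
def Un (ρ : Realization C 𝔥) : Subalgebra Kv (LoopAlg ρ) :=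
  Algebra.adjoin Kv {x | ∃ i l, x = uE ρ i l}

end LoopAlgebra

/-! ### Words in the generators of `U_v^+(L𝔤)` -/

/-- The generators `E_{i,l}`, `l ∈ ℤ`, and `H_{i,s}`, `s ≥ 1`, of `U_v^+(L𝔤)`. -/
inductive PosGen (n : ℕ) : Type
  | E (i : Fin n) (l : ℤ) : PosGen n
  | H (i : Fin n) (s : ℕ+) : PosGen n

/-- Words in the generators of `U_v^+(L𝔤)`. -/
abbrev Word (n : ℕ) : Type := FreeMonoid (PosGen n)

/-- The free algebra on the generators of `U_v^+(L𝔤)`, with the words as a basis. -/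
abbrev PosFree (n : ℕ) : Type := MonoidAlgebra Kv (Word n)

/-- A word as an element of the free algebra. -/
def word {n : ℕ} (w : Word n) : PosFree n := MonoidAlgebra.single w 1

def pE {n : ℕ} (i : Fin n) (l : ℤ) : PosFree n := word (FreeMonoid.of (PosGen.E i l))

def pH {n : ℕ} (i : Fin n) (s : ℕ+) : PosFree n := word (FreeMonoid.of (PosGen.H i s))

/-- `θ^+_{i,t}`: the coefficient of `z^t` in `exp ((v^{-1} - v) ∑_{s ≥ 1} H_{i,s} z^s)`. -/
def theta {n : ℕ} (i : Fin n) (t : ℕ) : PosFree n := expCoeff (v⁻¹ - v) (fun s => pH i s) t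

/-- The free algebra on the `E_{i,l}` alone. -/
def EFree (n : ℕ) : Subalgebra Kv (PosFree n) :=
  Algebra.adjoin Kv {x | ∃ i l, x = pE i l}

/-- The weight in `Q = ℤ^I` of a generator: `wt E_{i,l} = α_i` and `wt H_{i,s} = 0`. -/
def genWt {n : ℕ} : PosGen n → (Fin n → ℤ)
  | PosGen.E i _ => Pi.single i 1
  | PosGen.H _ _ => 0

/-- The weight of a word. -/
def wt {n : ℕ} (w : Word n) : Fin n → ℤ := (w.toList.map genWt).sum

theorem wt_one {n : ℕ} : wt (1 : Word n) = 0 := by simp [wt]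

theorem wt_mul {n : ℕ} (w w' : Word n) : wt (w * w') = wt w + wt w' := by simp [wt]

/-- The bilinear form on `Q` with `(α_i, α_j) = b i j`. -/
def CartanDatum.form {n : ℕ} (C : CartanDatum n) (x y : Fin n → ℤ) : ℤ :=
  ∑ i, ∑ j, x i * C.b i j * y j

/-! ### The completed twisted tensor square of the free algebra

Its elements are arbitrary formal sums `∑ f (w₁, w₂) w₁ ⊗ w₂` over pairs of words. A pair of words
has only finitely many factorizations, so products of such sums make sense. -/

/-- The factorizations of a word into two words. -/
def splits {n : ℕ} (w : Word n) : Finset (Word n × Word n) := by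
  classical
  exact (Finset.range (w.toList.length + 1)).image fun k =>
    (FreeMonoid.ofList (w.toList.take k), FreeMonoid.ofList (w.toList.drop k))

theorem mem_splits {n : ℕ} (w : Word n) (p : Word n × Word n) :
    p ∈ splits w ↔ p.1 * p.2 = w := by
  classical
  unfold splits
  simp only [Finset.mem_image, Finset.mem_range]
  constructor
  · rintro ⟨k, -, rfl⟩
    exact List.take_append_drop k w.toList
  · rintro rfl
    refine ⟨p.1.toList.length, ?_, ?_⟩
    · simp
    · ext1 <;> simp

/-- The factorizations of a pair of words in `Word n × Word n`. -/
def splits₂ {n : ℕ} (m : Word n × Word n) : Finset ((Word n × Word n) × (Word n × Word n)) := by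
  classical
  exact (splits m.1 ×ˢ splits m.2).image fun q => ((q.1.1, q.2.1), (q.1.2, q.2.2))

theorem mem_splits₂ {n : ℕ} (m : Word n × Word n) (p : (Word n × Word n) × (Word n × Word n)) :
    p ∈ splits₂ m ↔ p.1 * p.2 = m := by
  classical
  unfold splits₂
  simp only [Finset.mem_image, Finset.mem_product, mem_splits, Prod.ext_iff, Prod.fst_mul,
    Prod.snd_mul]
  constructor
  · rintro ⟨q, ⟨h1, h2⟩, ⟨h3, h4⟩, h5, h6⟩
    rw [← h3, ← h4, ← h5, ← h6]
    exact ⟨h1, h2⟩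
  · rintro ⟨h1, h2⟩
    exact ⟨((p.1.1, p.2.1), (p.1.2, p.2.2)), ⟨h1, h2⟩, ⟨rfl, rfl⟩, rfl, rfl⟩

/-- The completed tensor square. -/
def CTensor {n : ℕ} (_C : CartanDatum n) : Type := Word n × Word n → Kv

/-- The twist `v^{-(wt x₂, wt y₁)}` in the product `(x₁ ⊗ x₂) (y₁ ⊗ y₂)`. -/
def twist {n : ℕ} (C : CartanDatum n) (x y : Word n × Word n) : Kv :=
  v ^ (-C.form (wt x.2) (wt y.1))

namespace CTensor

variable {n : ℕ} {C : CartanDatum n}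

instance : AddCommGroup (CTensor C) := inferInstanceAs (AddCommGroup (Word n × Word n → Kv))

instance : Module Kv (CTensor C) := inferInstanceAs (Module Kv (Word n × Word n → Kv))

/-- The coefficient of `w₁ ⊗ w₂`. -/
def coeff (f : CTensor C) (m : Word n × Word n) : Kv := f m

@[ext] theorem ext {f g : CTensor C} (h : ∀ m, f.coeff m = g.coeff m) : f = g := funext h

@[simp] theorem coeff_add (f g : CTensor C) (m) : (f + g).coeff m = f.coeff m + g.coeff m := rfl
@[simp] theorem coeff_zero (m) : (0 : CTensor C).coeff m = 0 := rfl
@[simp] theorem coeff_smul (c : Kv) (f : CTensor C) (m) : (c • f).coeff m = c * f.coeff m := rfl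

/-- The tensor `x ⊗ y`. -/
def tmul (C : CartanDatum n) (x y : PosFree n) : CTensor C :=
  fun m => x.coeff m.1 * y.coeff m.2

instance : One (CTensor C) := ⟨tmul C 1 1⟩

/-- The product `(x₁ ⊗ x₂) (y₁ ⊗ y₂) = v^{-(wt x₂, wt y₁)} x₁ y₁ ⊗ x₂ y₂`. -/
instance : Mul (CTensor C) :=
  ⟨fun f g m => ∑ p ∈ splits₂ m, twist C p.1 p.2 * (f.coeff p.1 * g.coeff p.2)⟩

theorem coeff_mul (f g : CTensor C) (m : Word n × Word n) :
    (f * g).coeff m = ∑ p ∈ splits₂ m, twist C p.1 p.2 * (f.coeff p.1 * g.coeff p.2) := rfl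

theorem coeff_one_one : (1 : CTensor C).coeff 1 = 1 := by
  classical
  change (1 : PosFree n).coeff 1 * (1 : PosFree n).coeff 1 = _
  rw [MonoidAlgebra.one_def]
  simp

theorem coeff_one_of_ne {m : Word n × Word n} (h : m ≠ 1) : (1 : CTensor C).coeff m = 0 := by
  classical
  change (1 : PosFree n).coeff m.1 * (1 : PosFree n).coeff m.2 = _
  rw [MonoidAlgebra.one_def, mul_eq_zero]
  simp only [MonoidAlgebra.coeff_single, Finsupp.single_apply]
  by_contra hc
  push Not at hc
  apply h
  have h1 : 1 = m.1 := by
    by_contra h1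
    exact hc.1 (if_neg h1)
  have h2 : 1 = m.2 := by
    by_contra h2
    exact hc.2 (if_neg h2)
  exact Prod.ext h1.symm h2.symm

theorem twist_one_left (y : Word n × Word n) : twist C 1 y = 1 := by
  simp [twist, wt_one, CartanDatum.form]

theorem twist_one_right (x : Word n × Word n) : twist C x 1 = 1 := by
  simp [twist, wt_one, CartanDatum.form]

theorem v_ne_zero : v ≠ 0 := RatFunc.X_ne_zero

theorem twist_mul_left (x y z : Word n × Word n) :
    twist C (x * y) z = twist C x z * twist C y z := by
  unfold twist
  rw [← zpow_add₀ v_ne_zero]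
  congr 1
  simp only [CartanDatum.form, Prod.snd_mul, wt_mul, Pi.add_apply, add_mul,
    Finset.sum_add_distrib]
  ring

theorem twist_mul_right (x y z : Word n × Word n) :
    twist C x (y * z) = twist C x y * twist C x z := by
  unfold twist
  rw [← zpow_add₀ v_ne_zero]
  congr 1
  simp only [CartanDatum.form, Prod.fst_mul, wt_mul, Pi.add_apply, mul_add,
    Finset.sum_add_distrib]
  ring

protected theorem one_mul (f : CTensor C) : 1 * f = f := by
  ext m
  rw [coeff_mul, Finset.sum_eq_single (1, m)]
  · simp [coeff_one_one, twist_one_left]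
  · rintro p hp hne
    rw [mem_splits₂] at hp
    rw [coeff_one_of_ne]
    · simp
    · intro h
      apply hne
      rw [h, _root_.one_mul] at hp
      exact Prod.ext h hp
  · intro h
    exact absurd ((mem_splits₂ _ _).2 (_root_.one_mul m)) h

protected theorem mul_one (f : CTensor C) : f * 1 = f := by
  ext m
  rw [coeff_mul, Finset.sum_eq_single (m, 1)]
  · simp [coeff_one_one, twist_one_right]
  · rintro p hp hne
    rw [mem_splits₂] at hp
    rw [coeff_one_of_ne]
    · simp
    · intro h
      apply hne
      rw [h, _root_.mul_one] at hp
      exact Prod.ext hp h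
  · intro h
    exact absurd ((mem_splits₂ _ _).2 (_root_.mul_one m)) h

protected theorem mul_assoc (f g h : CTensor C) : f * g * h = f * (g * h) := by
  ext m
  simp only [coeff_mul, Finset.sum_mul, Finset.mul_sum]
  rw [Finset.sum_sigma', Finset.sum_sigma']
  refine Finset.sum_bij' (fun x _ => ⟨(x.2.1, x.2.2 * x.1.2), (x.2.2, x.1.2)⟩)
    (fun x _ => ⟨(x.1.1 * x.2.1, x.2.2), (x.1.1, x.2.1)⟩) ?_ ?_ ?_ ?_ ?_
  · rintro ⟨⟨a, b⟩, ⟨c, d⟩⟩ hx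
    simp only [Finset.mem_sigma, mem_splits₂] at hx ⊢
    refine ⟨?_, trivial⟩
    rw [← hx.1, ← hx.2, _root_.mul_assoc]
  · rintro ⟨⟨a, b⟩, ⟨c, d⟩⟩ hx
    simp only [Finset.mem_sigma, mem_splits₂] at hx ⊢
    refine ⟨?_, trivial⟩
    rw [← hx.1, ← hx.2, _root_.mul_assoc]
  · rintro ⟨⟨a, b⟩, ⟨c, d⟩⟩ hx
    simp only [Finset.mem_sigma, mem_splits₂] at hx
    obtain ⟨-, rfl⟩ := hx
    rfl
  · rintro ⟨⟨a, b⟩, ⟨c, d⟩⟩ hx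
    simp only [Finset.mem_sigma, mem_splits₂] at hx
    obtain ⟨-, rfl⟩ := hx
    rfl
  · rintro ⟨⟨a, b⟩, ⟨c, d⟩⟩ hx
    simp only [Finset.mem_sigma, mem_splits₂] at hx
    obtain ⟨-, rfl⟩ := hx
    simp only [twist_mul_left, twist_mul_right]
    ring

instance : Ring (CTensor C) :=
  { (inferInstance : AddCommGroup (CTensor C)), (inferInstance : One (CTensor C)),
    (inferInstance : Mul (CTensor C)) with
    one_mul := CTensor.one_mul
    mul_one := CTensor.mul_one
    mul_assoc := CTensor.mul_assoc
    left_distrib := fun f g h => by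
      ext m
      simp only [coeff_mul, coeff_add, mul_add, Finset.sum_add_distrib]
    right_distrib := fun f g h => by
      ext m
      simp only [coeff_mul, coeff_add, add_mul, mul_add, Finset.sum_add_distrib]
    zero_mul := fun f => by
      ext m
      simp [coeff_mul]
    mul_zero := fun f => by
      ext m
      simp [coeff_mul] }

instance : Algebra Kv (CTensor C) :=
  Algebra.ofModule
    (fun c f g => by
      ext m
      simp only [coeff_mul, coeff_smul, Finset.mul_sum]
      exact Finset.sum_congr rfl fun p _ => by ring)
    (fun c f g => by
      ext m
      simp only [coeff_mul, coeff_smul, Finset.mul_sum]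
      exact Finset.sum_congr rfl fun p _ => by ring)

end CTensor

/-! ### The coproduct `Δ'`, the Hopf pairing and the operators `F'_{i,n}` -/

section Coproduct

variable {n : ℕ}

/-- The infinite sum `∑_{t ≥ 0} θ^+_{i,t} ⊗ E_{i,l-t}`; at most one `t` contributes to the
coefficient of a given pair of words. -/
def thetaE (C : CartanDatum n) (i : Fin n) (l : ℤ) : CTensor C :=
  fun m => ∑ᶠ t : ℕ, (CTensor.tmul C (theta i t) (pE i (l - t))).coeff m

/-- `Δ'` on generators: `Δ'(E_{i,l}) = E_{i,l} ⊗ 1 + ∑_{t ≥ 0} θ^+_{i,t} ⊗ E_{i,l-t}`, and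
`Δ'(H_{i,s}) = H_{i,s} ⊗ 1 + 1 ⊗ H_{i,s}`, that is,
`Δ'(θ^+_{i,m}) = ∑_{0 ≤ t ≤ m} θ^+_{i,m-t} ⊗ θ^+_{i,t}` for all `m`. -/
def deltaGen (C : CartanDatum n) : PosGen n → CTensor C
  | PosGen.E i l => CTensor.tmul C (pE i l) 1 + thetaE C i l
  | PosGen.H i s => CTensor.tmul C (pH i s) 1 + CTensor.tmul C 1 (pH i s)

/-- The algebra homomorphism `Δ'`. -/
def delta (C : CartanDatum n) : PosFree n →ₐ[Kv] CTensor C :=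
  MonoidAlgebra.lift Kv (CTensor C) (Word n) (FreeMonoid.lift (deltaGen C))

/-- The value `(H_{i,s}, H_{j,t}) = δ_{s,t} [s b_{i,j}] / (s (v^{-1} - v))`. -/
def pairHH (C : CartanDatum n) (i : Fin n) (s : ℕ+) (j : Fin n) (t : ℕ+) : Kv :=
  if s = t then qInt v (((s : ℕ) : ℤ) * C.b i j) / (((s : ℕ) : Kv) * (v⁻¹ - v)) else 0

/-- The value `(E_{i,k}, E_{j,l}) = δ_{i,j} δ_{k,l} / (v^{-2} - 1)`. -/
def pairEE (i : Fin n) (k : ℤ) (j : Fin n) (l : ℤ) : Kv :=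
  if i = j ∧ k = l then (v ^ (-2 : ℤ) - 1)⁻¹ else 0

/-- The value `(w, E_{j,l})` for a word `w`, given by the values on generators and
`(x y, E_{j,l}) = (x ⊗ y, Δ'(E_{j,l}))`. Here `(H_{i,s}, θ^+_{j,t})` is
`δ_{s,t} (v^{-1} - v) (H_{i,s}, H_{j,s})`, because `H_{i,s}` is primitive and hence orthogonal to
products of elements of the augmentation ideal. -/
def pairE (C : CartanDatum n) (j : Fin n) : ℤ → List (PosGen n) → Kv
  | _, [] => 0
  | l, [PosGen.E i k] => pairEE i k j l
  | _, PosGen.E _ _ :: _ :: _ => 0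
  | l, PosGen.H i s :: w => (v⁻¹ - v) * pairHH C i s j s * pairE C j (l - ((s : ℕ) : ℤ)) w

/-- The value `(w, H_{j,t})` for a word `w`, given by the values on generators and
`(x y, H_{j,t}) = (x ⊗ y, Δ'(H_{j,t}))`. -/
def pairH (C : CartanDatum n) (j : Fin n) (t : ℕ+) : List (PosGen n) → Kv
  | [PosGen.H i s] => pairHH C i s j t
  | _ => 0

/-- The value `(w, g)` for a word `w` and a generator `g`. -/
def pairGen (C : CartanDatum n) (w : Word n) : PosGen n → Kv
  | PosGen.E j l => pairE C j l w.toList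
  | PosGen.H j t => pairH C j t w.toList

/-- The value `(x, y)` of the Hopf pairing on words: `(x, 1) = ε(x)` and
`(x, g y) = (Δ'(x), g ⊗ y)` for a generator `g`, where `(x₁ ⊗ x₂, g ⊗ y) = (x₁, g) (x₂, y)`. -/
def pairWord (C : CartanDatum n) : List (PosGen n) → Word n → Kv
  | [], x => if x.toList = [] then 1 else 0
  | g :: y, x => ∑ᶠ m : Word n × Word n,
      (delta C (word x)).coeff m * (pairGen C m.1 g * pairWord C y m.2)

/-- The Hopf pairing as a bilinear form `(x, y)` on the free algebra. -/
def pairing (C : CartanDatum n) (x y : PosFree n) : Kv :=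
  x.coeff.sum fun a c => y.coeff.sum fun b d => c * d * pairWord C b.toList a

/-- `F'_{i,k}(x) = ∑ (v^{-2} - 1) (E_{i,k}, x_{(1)}) x_{(2)}`, where
`Δ'(x) = ∑ x_{(1)} ⊗ x_{(2)}`. -/
def Fprime (C : CartanDatum n) (i : Fin n) (k : ℤ) (x : PosFree n) : PosFree n :=
  ∑ᶠ m : Word n × Word n, ((v ^ (-2 : ℤ) - 1) *
    (pairing C (pE i k) (word m.1) * (delta C x).coeff m)) • word m.2

end Coproduct

/-! ### Passing to `U_v(L𝔫)` -/

section Descent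

variable {n : ℕ} {C : CartanDatum n} {𝔥 : Type*} [AddCommGroup 𝔥] [Module ℂ 𝔥]

/-- The canonical homomorphism from the free algebra to `U_v(L𝔤)`. Its image is `U_v^+(L𝔤)`, and
the image of `EFree n` is `U_v(L𝔫)`. -/
def proj (ρ : Realization C 𝔥) : PosFree n →ₐ[Kv] LoopAlg ρ :=
  MonoidAlgebra.lift Kv (LoopAlg ρ) (Word n) (FreeMonoid.lift fun g =>
    match g with
    | PosGen.E i l => uE ρ i l
    | PosGen.H i s => uH ρ i s)

/-- `F k u = F'_{i,k}(u)` for all `k ∈ ℤ` and `u ∈ U_v(L𝔫)`: the operators `F k` on `U_v(L𝔫)` are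
given by the formula `u ↦ ∑ (v^{-2} - 1) (E_{i,k}, u_{(1)}) u_{(2)}`, computed on any expression `x`
of `u` through the generators `E_{j,l}`. -/
def IsFprime (ρ : Realization C 𝔥) (i : Fin n) (F : ℤ → Module.End Kv (Un ρ)) : Prop :=
  ∀ x ∈ EFree n, ∀ u : Un ρ, (u : LoopAlg ρ) = proj ρ x →
    ∀ k : ℤ, (F k u : LoopAlg ρ) = proj ρ (Fprime C i k x)

/-- `Z'_{i,k}`, the common kernel of the `F'_{i,m}` with `m ≤ k`: the elements of `U_v(L𝔫)` with an
expression `x` through the generators `E_{j,l}` such that `∑ (v^{-2} - 1) (E_{i,m}, x_{(1)}) x_{(2)}`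
vanishes in `U_v(L𝔤)` for all `m ≤ k`. -/
def Zprime (ρ : Realization C 𝔥) (i : Fin n) (k : ℤ) : Set (Un ρ) :=
  {u | ∃ x ∈ EFree n, proj ρ x = u ∧ ∀ m ≤ k, proj ρ (Fprime C i m x) = 0}

end Descent

end QLoop

end

/-! Everything rests on a twisted Leibniz rule on the free algebra. Multiply $\Delta'(E_{j,l})$ by
$\Delta'(y)$ and contract the first factor with $(v^{-2}-1)(E_{i,m},\cdot)$. The summand
$E_{j,l}\otimes1$ gives $\delta_{ij}\delta_{ml}\,y$ by the counit axiom (`hasContraction_counit`).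
The summand $\theta^+_{j,t}\otimes E_{j,l-t}$ gives $c_tE_{j,l-t}F'_{i,m-t}(y)$: a word in the $H$'s
of degree $t$ in front of $w$ turns $(E_{i,m},\cdot)$ into a multiple of $(E_{i,m-t},\cdot)$
(`ePair_isHWord_mul`), and the twist is constant because only first factors of weight $\alpha_i$
pair nontrivially (`wt_of_ePair_ne_zero`). This is `Fprime_pE_mul`.

Two features matter: indices only go down, so the range $m\le k$ is stable, and $c_t$ depends
neither on $m$ nor on $y$. Hence, if all $F'_{i,m}(y)$ with $m\le k$ die in the quotient, induction
on $x$ gives $F'_{i,m}(xy)=F'_{i,m}(x)\,y$ there (`proj_Fprime_mul`), and the common kernel is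
closed under products. The argument uses none of the defining relations, only that $\pi$ is a
homomorphism.

The analytic point is finiteness: `PairBound` says that $\Delta'(x)$ pairs to zero with $E_{i,m}$
for $m\ll0$, which truncates the sum over $t$. -/

namespace QLoop

variable {n : ℕ}

/-! ### Words in the `H_{i,s}` and their degrees -/

/-- `IsHWord t w`: the word `w` is a product of generators `H_{i,s}`, of total degree `t`. -/
inductive IsHWord : ℕ → List (PosGen n) → Prop
  | nil : IsHWord 0 []
  | cons (i : Fin n) (s : ℕ+) {t : ℕ} {w : List (PosGen n)} (h : IsHWord t w) :
      IsHWord (s + t) (PosGen.H i s :: w)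

theorem IsHWord.append {a b : ℕ} {w w' : List (PosGen n)} (h : IsHWord a w) (h' : IsHWord b w') :
    IsHWord (a + b) (w ++ w') := by
  induction h with
  | nil => simpa using h'
  | cons i s _ ih =>
    rw [List.cons_append, add_assoc]
    exact .cons i s ih

theorem IsHWord.eq_zero_of_nil {t : ℕ} (h : IsHWord t ([] : List (PosGen n))) : t = 0 := by
  cases h
  rfl

theorem IsHWord.eq_of_singleton {t : ℕ} {g : PosGen n} (h : IsHWord t [g]) :
    ∃ i, ∃ s : ℕ+, g = PosGen.H i s ∧ t = s := by
  cases h with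
  | cons i s h => exact ⟨i, s, rfl, by rw [h.eq_zero_of_nil]; rfl⟩

/-- The span of the words in the `H_{i,s}` of degree `t`. -/
def hPart (n t : ℕ) : Submodule Kv (PosFree n) where
  carrier := {x | ∀ w, x.coeff w ≠ 0 → IsHWord t w.toList}
  zero_mem' := fun w hw => absurd rfl hw
  add_mem' := by
    intro x y hx hy w hw
    by_cases h : x.coeff w = 0
    · exact hy w fun h' => hw (by simp [h, h'])
    · exact hx w h
  smul_mem' := by
    intro c x hx w hw
    exact hx w fun h' => hw (by simp [h'])

theorem coeff_word [DecidableEq (Word n)] (w w' : Word n) :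
    (word w).coeff w' = if w = w' then 1 else 0 := by
  classical
  rw [word, MonoidAlgebra.coeff_single, Finsupp.single_apply]

theorem word_mem_hPart {t : ℕ} {w : Word n} (h : IsHWord t w.toList) : word w ∈ hPart n t := by
  classical
  intro w' hw'
  rw [coeff_word] at hw'
  by_cases hww : w = w'
  · rwa [← hww]
  · exact absurd (if_neg hww) hw'

theorem one_mem_hPart : (1 : PosFree n) ∈ hPart n 0 := word_mem_hPart (w := 1) .nil

theorem mul_mem_hPart {a b : ℕ} {x y : PosFree n} (hx : x ∈ hPart n a) (hy : y ∈ hPart n b) :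
    x * y ∈ hPart n (a + b) := by
  classical
  intro w hw
  rw [MonoidAlgebra.coeff_mul] at hw
  obtain ⟨u, hu, hw⟩ := Finset.exists_ne_zero_of_sum_ne_zero hw
  obtain ⟨u', hu', hw⟩ := Finset.exists_ne_zero_of_sum_ne_zero hw
  have hww : u * u' = w := by
    by_contra h
    exact hw (if_neg h)
  rw [← hww, FreeMonoid.toList_mul]
  exact (hx u (Finsupp.mem_support_iff.1 hu)).append (hy u' (Finsupp.mem_support_iff.1 hu'))

theorem coeff_pow_mem_hPart {f : PowerSeries (PosFree n)}
    (hf : ∀ t, PowerSeries.coeff t f ∈ hPart n t) (k t : ℕ) :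
    PowerSeries.coeff t (f ^ k) ∈ hPart n t := by
  induction k generalizing t with
  | zero =>
    rw [pow_zero, PowerSeries.coeff_one]
    split_ifs with h
    · rw [h]; exact one_mem_hPart
    · exact zero_mem _
  | succ k ih =>
    rw [pow_succ, PowerSeries.coeff_mul]
    refine sum_mem fun p hp => ?_
    rw [← Finset.HasAntidiagonal.mem_antidiagonal.1 hp]
    exact mul_mem_hPart (ih _) (hf _)

/-- With $H_{i,s}$ in degree $s$, the coefficient of $z^s$ in the exponent is homogeneous of degree
$s$, and powers of such a series keep this property. -/
theorem theta_mem_hPart (i : Fin n) (t : ℕ) : theta i t ∈ hPart n t := by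
  refine sum_mem fun k _ => Submodule.smul_mem _ _ (coeff_pow_mem_hPart (fun s => ?_) _ _)
  rw [PowerSeries.coeff_mk]
  split_ifs with h
  · exact Submodule.smul_mem _ _ (word_mem_hPart (.cons i ⟨s, h⟩ .nil))
  · exact zero_mem _

theorem isHWord_of_coeff_theta {i : Fin n} {t : ℕ} {w : Word n} (h : (theta i t).coeff w ≠ 0) :
    IsHWord t w.toList :=
  theta_mem_hPart i t w h

theorem theta_zero (i : Fin n) : theta i 0 = (1 : PosFree n) := by
  simp [theta, expCoeff]

/-! ### The coproduct on generators -/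

theorem coeff_pE [DecidableEq (Word n)] (i : Fin n) (l : ℤ) (w : Word n) :
    (pE i l).coeff w = if FreeMonoid.of (PosGen.E i l) = w then 1 else 0 :=
  coeff_word _ _

theorem of_E_inj {i j : Fin n} {l m : ℤ} :
    FreeMonoid.of (PosGen.E i l) = FreeMonoid.of (PosGen.E j m) ↔ i = j ∧ l = m := by
  rw [FreeMonoid.of_injective.eq_iff, PosGen.E.injEq]

theorem coeff_tmul (C : CartanDatum n) (x y : PosFree n) (p : Word n × Word n) :
    (CTensor.tmul C x y).coeff p = x.coeff p.1 * y.coeff p.2 := rfl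

/-- A tensor occurring in `∑_{t ≥ 0} θ^+_{i,t} ⊗ E_{i,l-t}` occurs in exactly one summand. -/
theorem exists_of_coeff_thetaE {C : CartanDatum n} {i : Fin n} {l : ℤ} {p : Word n × Word n}
    (h : (thetaE C i l).coeff p ≠ 0) :
    ∃ t : ℕ, IsHWord t p.1.toList ∧ p.2 = FreeMonoid.of (PosGen.E i (l - t)) := by
  classical
  obtain ⟨t, ht⟩ : ∃ t : ℕ, (CTensor.tmul C (theta i t) (pE i (l - t))).coeff p ≠ 0 := by
    by_contra hc
    push Not at hc
    exact h (finsum_eq_zero_of_forall_eq_zero hc)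
  rw [coeff_tmul, coeff_pE] at ht
  refine ⟨t, isHWord_of_coeff_theta (left_ne_zero_of_mul ht), ?_⟩
  by_contra hp
  exact ht (by rw [if_neg fun h => hp h.symm, mul_zero])

/-- Truncation of `∑_{t ≥ 0} θ^+_{i,t} ⊗ E_{i,l-t}`. -/
theorem coeff_thetaE_eq_sum (C : CartanDatum n) (i : Fin n) (l : ℤ) (p : Word n × Word n) (N : ℕ)
    (h : ∀ t : ℕ, IsHWord t p.1.toList → p.2 = FreeMonoid.of (PosGen.E i (l - t)) → t < N) :
    (thetaE C i l).coeff p =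
      ∑ t ∈ Finset.range N, (CTensor.tmul C (theta i t) (pE i (l - t))).coeff p := by
  classical
  refine finsum_eq_sum_of_support_subset _ fun t ht => ?_
  rw [Function.mem_support, coeff_tmul, coeff_pE] at ht
  rw [Finset.coe_range, Set.mem_Iio]
  refine h t (isHWord_of_coeff_theta (left_ne_zero_of_mul ht)) ?_
  by_contra hp
  exact ht (by rw [if_neg fun h => hp h.symm, mul_zero])

theorem coeff_thetaE_of (C : CartanDatum n) (i : Fin n) (l : ℤ) (w : Word n) (t : ℕ) :
    (thetaE C i l).coeff (w, FreeMonoid.of (PosGen.E i (l - t))) = (theta i t).coeff w := by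
  classical
  refine (finsum_eq_single _ t fun s hs => ?_).trans ?_
  · rw [coeff_tmul, coeff_pE, if_neg, mul_zero]
    rw [of_E_inj]
    rintro ⟨-, h⟩
    omega
  · rw [coeff_tmul, coeff_pE, if_pos rfl, mul_one]

theorem delta_word_of (C : CartanDatum n) (g : PosGen n) :
    delta C (word (FreeMonoid.of g)) = deltaGen C g := by
  rw [delta, word, MonoidAlgebra.lift_single, one_smul, FreeMonoid.lift_eval_of]

theorem delta_pE (C : CartanDatum n) (i : Fin n) (l : ℤ) :
    delta C (pE i l) = CTensor.tmul C (pE i l) 1 + thetaE C i l :=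
  delta_word_of C _

/-! ### The functional `(v^{-2} - 1) (E_{i,m}, ·)` -/

/-- The functional `w ↦ (v^{-2} - 1) (E_{i,m}, w)` on words. -/
noncomputable def ePair (C : CartanDatum n) (i : Fin n) (m : ℤ) (w : Word n) : Kv :=
  (v ^ (-2 : ℤ) - 1) * pairing C (pE i m) (word w)

theorem pairing_word (C : CartanDatum n) (a b : Word n) :
    pairing C (word a) (word b) = pairWord C b.toList a := by
  simp [pairing, word, MonoidAlgebra.coeff_single]

theorem ePair_eq (C : CartanDatum n) (i : Fin n) (m : ℤ) (w : Word n) :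
    ePair C i m w =
      (v ^ (-2 : ℤ) - 1) * pairWord C w.toList (FreeMonoid.of (PosGen.E i m)) := by
  rw [ePair, pE, pairing_word]

theorem v_sq_sub_one_ne_zero : v ^ (-2 : ℤ) - 1 ≠ 0 := by
  intro h
  have h2 : v ^ 2 = 1 := by
    rw [sub_eq_zero, zpow_neg, inv_eq_one] at h
    exact_mod_cast h
  have h3 : (Polynomial.X ^ 2 : Polynomial ℂ) = 1 := by
    apply RatFunc.algebraMap_injective ℂ
    rw [map_pow, map_one, RatFunc.algebraMap_X]
    exact h2
  have := congrArg Polynomial.natDegree h3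
  simp at this

theorem pairGen_one (C : CartanDatum n) (g : PosGen n) : pairGen C 1 g = 0 := by
  cases g <;> rfl

/-- Pairing with $1$ is the counit: $\Delta'(1)=1\otimes1$, and $1$ is orthogonal to every
generator. -/
theorem pairWord_one (C : CartanDatum n) (y : List (PosGen n)) :
    pairWord C y 1 = if y = [] then 1 else 0 := by
  cases y with
  | nil => rfl
  | cons g y =>
    rw [if_neg (by simp), pairWord]
    refine finsum_eq_zero_of_forall_eq_zero fun p => ?_
    have h1 : delta C (word (1 : Word n)) = 1 := map_one (delta C)
    by_cases hp : p = 1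
    · rw [hp, Prod.fst_one, pairGen_one, zero_mul, mul_zero]
    · rw [h1, CTensor.coeff_one_of_ne hp, zero_mul]

theorem pairE_of_isHWord (C : CartanDatum n) (j : Fin n) {t : ℕ} {w : List (PosGen n)}
    (h : IsHWord t w) (l : ℤ) : pairE C j l w = 0 := by
  induction h generalizing l with
  | nil => rfl
  | cons i s _ ih => rw [pairE, ih, mul_zero]

theorem ePair_one (C : CartanDatum n) (i : Fin n) (m : ℤ) : ePair C i m 1 = 0 := by
  rw [ePair_eq, FreeMonoid.toList_one, pairWord, if_neg, mul_zero]
  simp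

theorem tmul_pE_one_coeff (C : CartanDatum n) (i : Fin n) (m : ℤ) {p : Word n × Word n}
    (h : (CTensor.tmul C (pE i m) 1).coeff p ≠ 0) : p = (FreeMonoid.of (PosGen.E i m), 1) := by
  classical
  rw [coeff_tmul, coeff_pE] at h
  refine Prod.ext ?_ ?_
  · by_contra hp
    exact h (by rw [if_neg fun h => hp h.symm, zero_mul])
  · have h2 := right_ne_zero_of_mul h
    rw [show (1 : PosFree n) = word 1 from rfl, coeff_word] at h2
    by_contra hp
    exact h2 (if_neg fun h => hp h.symm)

/-- The counit on words. -/
noncomputable def counit (w : Word n) : Kv := if w.toList = [] then 1 else 0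

theorem counit_one : counit (1 : Word n) = 1 := rfl

theorem counit_of_ne {w : Word n} (h : w ≠ 1) : counit w = 0 :=
  if_neg fun h' => h (FreeMonoid.toList.injective h')

/-- The first letter $E_{j,l}$ is paired with the first factor of $\Delta'(E_{i,m})$. It is
orthogonal to all words in the $H$'s, so only $E_{i,m}\otimes1$ survives, and $w$ is then paired
with $1$. -/
theorem ePair_E_mul (C : CartanDatum n) (i j : Fin n) (m l : ℤ) (w : Word n) :
    ePair C i m (FreeMonoid.of (PosGen.E j l) * w) =
      if i = j ∧ m = l then counit w else 0 := by
  classical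
  rw [ePair_eq, FreeMonoid.toList_mul, FreeMonoid.toList_of, List.singleton_append, pairWord,
    delta_word_of]
  rw [finsum_eq_single _ (FreeMonoid.of (PosGen.E i m), 1)]
  · have h0 : (thetaE C i m).coeff (FreeMonoid.of (PosGen.E i m), 1) = 0 := by
      by_contra h
      obtain ⟨t, -, h⟩ := exists_of_coeff_thetaE h
      exact absurd h.symm (FreeMonoid.of_ne_one _)
    have h1 : (deltaGen C (PosGen.E i m)).coeff (FreeMonoid.of (PosGen.E i m), 1) = 1 := by
      rw [deltaGen, CTensor.coeff_add, h0, coeff_tmul, coeff_pE, if_pos rfl,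
        MonoidAlgebra.coeff_one_one]
      simp
    rw [h1, pairWord_one]
    change (v ^ (-2 : ℤ) - 1) * (1 * (pairEE i m j l * _)) = _
    rw [pairEE]
    by_cases hij : i = j ∧ m = l
    · rw [if_pos hij, if_pos hij, one_mul, ← mul_assoc, mul_inv_cancel₀ v_sq_sub_one_ne_zero,
        one_mul]
      rfl
    · rw [if_neg hij, if_neg hij, zero_mul, mul_zero, mul_zero]
  · intro p hp
    by_cases h : (CTensor.tmul C (pE i m) 1).coeff p = 0
    · rw [deltaGen, CTensor.coeff_add, h, zero_add]
      by_cases h' : (thetaE C i m).coeff p = 0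
      · rw [h', zero_mul]
      · obtain ⟨t, ht, -⟩ := exists_of_coeff_thetaE h'
        rw [pairGen, pairE_of_isHWord C j ht, zero_mul, mul_zero]
    · exact absurd (tmul_pE_one_coeff C i m h) hp

theorem eq_of_pairH_ne_zero {C : CartanDatum n} {j : Fin n} {s : ℕ+} {w : List (PosGen n)}
    (h : pairH C j s w ≠ 0) : ∃ i, w = [PosGen.H i s] := by
  match w, h with
  | [PosGen.H i t], h =>
    refine ⟨i, ?_⟩
    have : t = s := by
      by_contra hts
      exact h (if_neg hts)
    rw [this]
  | [], h => exact absurd rfl h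
  | [PosGen.E _ _], h => exact absurd rfl h
  | _ :: _ :: _, h => exact absurd (by simp [pairH]) h

/-- $H_{j,s}$ pairs nontrivially only with one-letter words $H_{a,s}$. In $\Delta'(E_{i,m})$ these
occur as first factor only in $\theta^+_{i,s}\otimes E_{i,m-s}$, and their coefficients do not
involve $m$. -/
theorem ePair_H_mul (C : CartanDatum n) (i j : Fin n) (s : ℕ+) :
    ∃ c : Kv, ∀ (m : ℤ) (w : Word n),
      ePair C i m (FreeMonoid.of (PosGen.H j s) * w) = c * ePair C i (m - (s : ℕ)) w := by
  classical
  -- This is $(H_{j,s},\theta^+_{i,s})$, left unevaluated. Summing over all $a$ makes it unnecessary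
  -- to know which $H_{a,s}$ occur in $\theta^+_{i,s}$.
  refine ⟨∑ a : Fin n, (theta i s).coeff (FreeMonoid.of (PosGen.H a s)) * pairHH C a s j s,
    fun m w => ?_⟩
  let e : Fin n → Word n × Word n := fun a =>
    (FreeMonoid.of (PosGen.H a s), FreeMonoid.of (PosGen.E i (m - (s : ℕ))))
  have he : Function.Injective e := fun a b h => by
    have := FreeMonoid.of_injective (congrArg Prod.fst h)
    exact (PosGen.H.injEq .. ▸ this).1
  rw [ePair_eq, ePair_eq, FreeMonoid.toList_mul, FreeMonoid.toList_of, List.singleton_append,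
    pairWord, delta_word_of, finsum_eq_sum_of_support_subset (s := Finset.univ.image e),
    Finset.sum_image he.injOn, mul_left_comm, Finset.sum_mul]
  · congr 1
    refine Finset.sum_congr rfl fun a _ => ?_
    have h0 : (CTensor.tmul C (pE i m) 1).coeff (e a) = 0 := by
      by_contra h
      have := congrArg Prod.snd (tmul_pE_one_coeff C i m h)
      exact absurd this (FreeMonoid.of_ne_one _)
    rw [deltaGen, CTensor.coeff_add, h0, zero_add, coeff_thetaE_of, mul_assoc]
    rfl
  · intro p hp
    rw [Function.mem_support] at hp
    obtain ⟨a, ha⟩ := eq_of_pairH_ne_zero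
      (left_ne_zero_of_mul (right_ne_zero_of_mul hp) : pairH C j s p.1.toList ≠ 0)
    have h0 : (CTensor.tmul C (pE i m) 1).coeff p = 0 := by
      by_contra h
      have h1 := congrArg Prod.fst (tmul_pE_one_coeff C i m h)
      rw [h1] at ha
      simp at ha
    have h1 := left_ne_zero_of_mul hp
    rw [deltaGen, CTensor.coeff_add, h0, zero_add] at h1
    obtain ⟨t, ht, hp2⟩ := exists_of_coeff_thetaE h1
    rw [ha] at ht
    obtain ⟨a', s', hg, hts⟩ := ht.eq_of_singleton
    obtain ⟨-, rfl⟩ := (PosGen.H.injEq .. ▸ hg)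
    subst hts
    rw [Finset.coe_image, Finset.coe_univ, Set.image_univ]
    exact ⟨a, Prod.ext (FreeMonoid.toList.injective ha.symm) hp2.symm⟩

/-- On a product with a word in the `H_{j,s}` of degree `t`, the functional `(E_{i,m}, ·)` is a
multiple of `(E_{i,m-t}, ·)`. -/
theorem ePair_isHWord_mul (C : CartanDatum n) (i : Fin n) {t : ℕ} {h : List (PosGen n)}
    (hh : IsHWord t h) :
    ∃ c : Kv, ∀ (m : ℤ) (w : Word n),
      ePair C i m (FreeMonoid.ofList h * w) = c * ePair C i (m - t) w := by
  induction hh with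
  | nil => exact ⟨1, fun m w => by simp⟩
  | @cons j s t h _ ih =>
    obtain ⟨c, hc⟩ := ih
    obtain ⟨d, hd⟩ := ePair_H_mul C i j s
    refine ⟨d * c, fun m w => ?_⟩
    rw [FreeMonoid.ofList_cons, mul_assoc, hd, hc, mul_assoc]
    congr 3
    push_cast
    ring

theorem wt_of (g : PosGen n) : wt (FreeMonoid.of g) = genWt g := by simp [wt]

/-- Makes the twist a constant on all terms that survive the contraction. -/
theorem wt_of_ePair_ne_zero {C : CartanDatum n} {i : Fin n} {m : ℤ} {w : Word n}
    (h : ePair C i m w ≠ 0) : wt w = Pi.single i 1 := by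
  induction w using FreeMonoid.inductionOn' generalizing m with
  | one => exact absurd (ePair_one C i m) h
  | of_mul g w ih =>
    cases g with
    | E j l =>
      rw [ePair_E_mul] at h
      by_cases hij : i = j ∧ m = l
      · rw [if_pos hij] at h
        have hw : w = 1 := by
          by_contra hw
          exact h (counit_of_ne hw)
        rw [hw, mul_one, wt_of, hij.1]
        rfl
      · exact absurd (if_neg hij) h
    | H j s =>
      obtain ⟨c, hc⟩ := ePair_H_mul C i j s
      rw [hc] at h
      rw [wt_mul, ih (right_ne_zero_of_mul h), wt_of]
      exact zero_add _



/-! ### Contracting the first tensor factor -/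

/-- `HasContraction ψ f r`: the sum `∑ ψ (w₁ ⊗ w₂) f (w₁, w₂) w₂` is finite, with value `r`. -/
def HasContraction {C : CartanDatum n} (ψ : Word n × Word n → Kv) (f : CTensor C)
    (r : PosFree n) : Prop :=
  (fun p => (ψ p * f.coeff p) • word p.2).HasFiniteSupport ∧
    ∑ᶠ p, (ψ p * f.coeff p) • word p.2 = r

namespace HasContraction

variable {C : CartanDatum n} {ψ ψ' : Word n × Word n → Kv} {f g : CTensor C} {r s : PosFree n}

theorem congr (h : HasContraction ψ f r) (he : ∀ p, ψ' p * g.coeff p = ψ p * f.coeff p) :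
    HasContraction ψ' g r := by
  simpa only [HasContraction, he] using h

theorem zero (h : ∀ p, ψ p * f.coeff p = 0) : HasContraction ψ f 0 := by
  simp only [HasContraction, h, zero_smul, finsum_zero, and_true]
  exact (by simp : (Function.support fun _ : Word n × Word n => (0 : PosFree n)).Finite)

theorem add (hf : HasContraction ψ f r) (hg : HasContraction ψ g s) :
    HasContraction ψ (f + g) (r + s) := by
  simp only [HasContraction, CTensor.coeff_add, mul_add, add_smul]
  exact ⟨hf.1.add hg.1, by rw [finsum_add_distrib hf.1 hg.1, hf.2, hg.2]⟩

theorem smul (c : Kv) (hf : HasContraction ψ f r) : HasContraction ψ (c • f) (c • r) := by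
  simp only [HasContraction, CTensor.coeff_smul, mul_left_comm _ c, mul_smul c]
  exact ⟨hf.1.subset fun p hp h => hp (by simp only at h; simp only [h, smul_zero]),
    by rw [← smul_finsum, hf.2]⟩

theorem sum {ι : Type*} (T : Finset ι) {F : ι → CTensor C} {R : ι → PosFree n}
    (h : ∀ t ∈ T, HasContraction ψ (F t) (R t)) :
    HasContraction ψ (∑ t ∈ T, F t) (∑ t ∈ T, R t) := by
  classical
  induction T using Finset.induction_on with
  | empty => exact zero fun p => by simp
  | insert a T ha ih =>
    rw [Finset.sum_insert ha, Finset.sum_insert ha]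
    exact (h a (Finset.mem_insert_self _ _)).add
      (ih fun t ht => h t (Finset.mem_insert_of_mem ht))

end HasContraction

section WordTensor

variable {C : CartanDatum n}

theorem word_pair_mul_left_cancel {x y z : Word n × Word n} (h : x * y = x * z) : y = z :=
  Prod.ext (mul_left_cancel (congrArg Prod.fst h)) (mul_left_cancel (congrArg Prod.snd h))

theorem coeff_tmul_word_mul_of_ne (u u' : Word n) (f : CTensor C) (p : Word n × Word n)
    (h : ∀ q, (u, u') * q ≠ p) : (CTensor.tmul C (word u) (word u') * f).coeff p = 0 := by
  classical
  rw [CTensor.coeff_mul]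
  refine Finset.sum_eq_zero fun x hx => ?_
  rw [mem_splits₂] at hx
  rw [coeff_tmul, coeff_word, coeff_word]
  by_cases h1 : u = x.1.1
  · by_cases h2 : u' = x.1.2
    · exact absurd (by rw [← hx, h1, h2]) (h x.2)
    · simp [h2]
  · simp [h1]

theorem coeff_tmul_word_mul (u u' : Word n) (f : CTensor C) (q : Word n × Word n) :
    (CTensor.tmul C (word u) (word u') * f).coeff ((u, u') * q) =
      twist C (u, u') q * f.coeff q := by
  classical
  rw [CTensor.coeff_mul, Finset.sum_eq_single ((u, u'), q)]
  · simp [coeff_tmul, coeff_word]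
  · intro x hx hne
    rw [mem_splits₂] at hx
    rw [coeff_tmul, coeff_word, coeff_word]
    by_cases h1 : u = x.1.1
    · by_cases h2 : u' = x.1.2
      · have h3 : x.1 = (u, u') := Prod.ext h1.symm h2.symm
        rw [h3] at hx
        exact absurd (Prod.ext h3 (word_pair_mul_left_cancel hx)) hne
      · simp [h2]
    · simp [h1]
  · intro h
    exact absurd ((mem_splits₂ ((u, u') * q) ((u, u'), q)).2 rfl) h

theorem word_mul (u w : Word n) : word (u * w) = word u * word w := by
  simp [word, MonoidAlgebra.single_mul_single]

/-- Left multiplication by $(u,u')$ is injective on pairs of words and its image carries the support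
of the product, so the contraction can be reindexed along it. The twist is absorbed into the
functional. -/
theorem HasContraction.tmul_word_mul {u u' : Word n} {ψ : Word n × Word n → Kv} {f : CTensor C}
    {r : PosFree n}
    (h : HasContraction (fun q => ψ ((u, u') * q) * twist C (u, u') q) f r) :
    HasContraction ψ (CTensor.tmul C (word u) (word u') * f) (word u' * r) := by
  set G : Word n × Word n → PosFree n := fun p =>
    (ψ p * (CTensor.tmul C (word u) (word u') * f).coeff p) • word p.2 with hG
  have hinj : Function.Injective fun q => (u, u') * q := fun _ _ => word_pair_mul_left_cancel
  have hsub : Function.support G ⊆ Set.range fun q => (u, u') * q := by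
    intro p hp
    by_contra hc
    refine hp ?_
    rw [hG]
    simp only
    rw [coeff_tmul_word_mul_of_ne _ _ _ _ fun q hq => hc ⟨q, hq⟩, mul_zero, zero_smul]
  have hGq : ∀ q, G ((u, u') * q) =
      word u' * ((ψ ((u, u') * q) * twist C (u, u') q * f.coeff q) • word q.2) := by
    intro q
    rw [hG]
    simp only
    rw [coeff_tmul_word_mul, Prod.snd_mul, word_mul, mul_smul_comm, mul_assoc]
  refine ⟨?_, ?_⟩
  · refine Set.Finite.subset (h.1.image fun q => (u, u') * q) fun p hp => ?_
    obtain ⟨q, rfl⟩ := hsub hp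
    refine ⟨q, fun hq => hp ?_, rfl⟩
    change G _ = 0
    rw [hGq]
    simp only at hq
    rw [hq, mul_zero]
  · change ∑ᶠ p, G p = _
    rw [← finsum_mem_univ, ← finsum_mem_inter_support, Set.univ_inter,
      ← Set.inter_eq_right.2 hsub, finsum_mem_inter_support, finsum_mem_range hinj,
      finsum_congr hGq, ← mul_finsum' _ _ h.1, h.2]

theorem tmul_eq_sum (x y : PosFree n) :
    CTensor.tmul C x y = ∑ u ∈ x.coeff.support, x.coeff u • CTensor.tmul C (word u) y := by
  classical
  ext p
  have h : ∀ T : Finset (Word n),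
      (∑ u ∈ T, x.coeff u • CTensor.tmul C (word u) y).coeff p =
        ∑ u ∈ T, x.coeff u * ((word u).coeff p.1 * y.coeff p.2) := by
    intro T
    induction T using Finset.induction_on with
    | empty => rfl
    | insert a T ha ih =>
      rw [Finset.sum_insert ha, Finset.sum_insert ha, CTensor.coeff_add, ih, CTensor.coeff_smul,
        coeff_tmul]
  rw [h, coeff_tmul]
  simp only [coeff_word, ite_mul, one_mul, zero_mul, mul_ite, mul_zero]
  rw [Finset.sum_ite_eq']
  split_ifs with hp
  · rfl
  · rw [Finsupp.notMem_support_iff.1 hp, zero_mul]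

theorem coeff_finset_sum {ι : Type*} (T : Finset ι) (F : ι → CTensor C) (p : Word n × Word n) :
    (∑ t ∈ T, F t).coeff p = ∑ t ∈ T, (F t).coeff p :=
  Finset.sum_apply p T F

end WordTensor

/-! ### Recursion for the contractions of `Δ'` -/

section Recursion

variable {C : CartanDatum n}

/-- The product `(∑_{t ≥ 0} θ^+_{j,t} ⊗ E_{j,l-t}) f` may be computed with a truncated sum, where the
remaining terms do not contribute. -/
theorem coeff_thetaE_mul (j : Fin n) (l : ℤ) (f : CTensor C) (N : ℕ) (p : Word n × Word n)
    (h : ∀ t : ℕ, N ≤ t → ∀ q r : Word n × Word n, IsHWord t q.1.toList → q * r = p →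
      f.coeff r = 0) :
    (thetaE C j l * f).coeff p =
      ((∑ t ∈ Finset.range N, CTensor.tmul C (theta j t) (pE j (l - t))) * f).coeff p := by
  rw [CTensor.coeff_mul, CTensor.coeff_mul]
  refine Finset.sum_congr rfl fun x hx => ?_
  rw [mem_splits₂] at hx
  by_cases hf : f.coeff x.2 = 0
  · simp only [hf, mul_zero]
  · rw [coeff_thetaE_eq_sum C j l x.1 N, coeff_finset_sum]
    intro t ht _
    by_contra hc
    exact hf (h t (not_lt.1 hc) x.1 x.2 ht hx)

theorem HasContraction.counit_delta_pE_mul {y : PosFree n} (j : Fin n) (l : ℤ)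
    (h : HasContraction (fun p => counit p.1) (delta C y) y) :
    HasContraction (fun p => counit p.1) (delta C (pE j l * y)) (pE j l * y) := by
  rw [map_mul, delta_pE, add_mul, ← zero_add (pE j l * y)]
  refine .add (.zero fun p => ?_) ?_
  · by_cases hp : p.1 = 1
    · rw [show (1 : PosFree n) = word 1 from rfl, pE, coeff_tmul_word_mul_of_ne, mul_zero]
      intro q hq
      rw [← hq] at hp
      exact absurd (congrArg FreeMonoid.toList hp) (by simp)
    · rw [counit_of_ne hp, zero_mul]
  · have h1 : HasContraction (fun p => counit p.1)
        (CTensor.tmul C (word 1) (word (FreeMonoid.of (PosGen.E j l))) * delta C y)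
        (pE j l * y) := by
      refine .tmul_word_mul (h.congr fun q => ?_)
      by_cases hq : q.1 = 1
      · simp [hq, twist, wt_one, CartanDatum.form]
      · simp [counit_of_ne hq]
    refine h1.congr fun p => ?_
    by_cases hp : p.1 = 1
    · rw [coeff_thetaE_mul j l _ 1]
      · rw [Finset.sum_range_one, theta_zero, Nat.cast_zero, sub_zero]
        rfl
      · intro t ht q r hq hqr
        have h2 : q.1 * r.1 = 1 := by rw [← hp, ← hqr]; rfl
        have h3 : q.1 = 1 := by
          apply FreeMonoid.toList.injective
          have := congrArg FreeMonoid.toList h2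
          rw [FreeMonoid.toList_mul] at this
          exact (List.append_eq_nil_iff.1 this).1
        rw [h3] at hq
        have := hq.eq_zero_of_nil
        omega
    · rw [counit_of_ne hp, zero_mul, zero_mul]

/-- The tensors in `f` do not pair with `E_{i,m}` in the first factor for `m < B`. -/
def PairBound (i : Fin n) (f : CTensor C) (B : ℤ) : Prop :=
  ∀ m < B, ∀ p : Word n × Word n, ePair C i m p.1 * f.coeff p = 0

theorem PairBound.mono {i : Fin n} {f : CTensor C} {B B' : ℤ} (h : PairBound i f B) (hB : B' ≤ B) :
    PairBound i f B' :=
  fun m hm => h m (hm.trans_le hB)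

/-- Removing an $H$-word of degree $t$ from the first factor lowers the index to $m-t$, where the
bound applies. -/
theorem PairBound.coeff_eq_zero {i : Fin n} {f : CTensor C} {B m : ℤ} (h : PairBound i f B)
    {t : ℕ} (hm : m - t < B) {q r : Word n × Word n} (hq : IsHWord t q.1.toList)
    (h0 : ePair C i m (q * r).1 ≠ 0) : f.coeff r = 0 := by
  obtain ⟨c, hc⟩ := ePair_isHWord_mul C i hq
  rw [Prod.fst_mul, show q.1 = FreeMonoid.ofList q.1.toList from rfl, hc] at h0
  exact (mul_eq_zero.1 (h _ hm r)).resolve_left (right_ne_zero_of_mul h0)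

theorem PairBound.delta_pE_mul {i j : Fin n} {l B : ℤ} {y : PosFree n}
    (h : PairBound i (delta C y) B) (hl : B ≤ l) : PairBound i (delta C (pE j l * y)) B := by
  intro m hm p
  by_cases h0 : ePair C i m p.1 = 0
  · rw [h0, zero_mul]
  -- Truncation at $0$: since $m-t\le m<B$, no term of the $\theta$-series contributes. The summand
  -- $E_{j,l}\otimes1$ needs $m=l$, excluded by $m<B\le l$.
  rw [map_mul, delta_pE, add_mul, CTensor.coeff_add, coeff_thetaE_mul j l _ 0]
  · rw [Finset.sum_range_zero, zero_mul, CTensor.coeff_zero, add_zero,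
      show (1 : PosFree n) = word 1 from rfl, pE, coeff_tmul_word_mul_of_ne, mul_zero]
    intro q hq
    refine h0 ?_
    rw [← hq, Prod.fst_mul, ePair_E_mul, if_neg]
    rintro ⟨-, rfl⟩
    omega
  · intro t _ q r hq hqr
    exact h.coeff_eq_zero (m := m) (by omega) hq (by rwa [hqr])

/-- The constant is chosen before $m$ and $f$; this uniformity is what later allows the expansions
for $x$ and for $xy$ to be compared term by term. -/
theorem exists_hasContraction_tmul_theta_mul (C : CartanDatum n) (i j : Fin n) (l : ℤ) (t : ℕ) :
    ∃ c : Kv, ∀ (m : ℤ) (f : CTensor C) (r : PosFree n),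
      HasContraction (fun p => ePair C i (m - t) p.1) f r →
      HasContraction (fun p => ePair C i m p.1)
        (CTensor.tmul C (theta j t) (pE j (l - t)) * f) (c • (pE j (l - t) * r)) := by
  have key : ∀ u ∈ (theta j t : PosFree n).coeff.support, ∃ c : Kv,
      ∀ (m : ℤ) (f : CTensor C) (r : PosFree n),
        HasContraction (fun p => ePair C i (m - t) p.1) f r →
        HasContraction (fun p => ePair C i m p.1)
          (CTensor.tmul C (word u) (pE j (l - t)) * f) (c • (pE j (l - t) * r)) := by
    intro u hu
    obtain ⟨c, hc⟩ := ePair_isHWord_mul C i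
      (isHWord_of_coeff_theta (Finsupp.mem_support_iff.1 hu))
    set d : Kv := v ^ (-C.form (wt (FreeMonoid.of (PosGen.E j (l - t)))) (Pi.single i 1))
    refine ⟨c * d, fun m f r hr => ?_⟩
    rw [← mul_smul_comm]
    refine .tmul_word_mul ((hr.smul (c * d)).congr fun q => ?_)
    rw [Prod.fst_mul, show u = FreeMonoid.ofList u.toList from rfl, hc, CTensor.coeff_smul]
    -- Either both sides vanish, or $q_1$ has weight $\alpha_i$ and the twist equals `d`.
    by_cases hq : ePair C i (m - t) q.1 = 0
    · simp only [hq, mul_zero, zero_mul]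
    · rw [twist, wt_of_ePair_ne_zero hq]
      ring
  choose! c hc using key
  refine ⟨∑ u ∈ (theta j t : PosFree n).coeff.support, (theta j t).coeff u * c u,
    fun m f r hr => ?_⟩
  rw [tmul_eq_sum, Finset.sum_mul, Finset.sum_smul]
  refine .sum _ fun u hu => ?_
  rw [smul_mul_assoc, mul_smul]
  exact (hc u hu m f r hr).smul _

/-- The recursion for `F'_{i,m}`: up to a leading term, `F'_{i,m}(E_{j,l} y)` is a combination of the
`E_{j,l-t} F'_{i,m-t}(y)` with `t ≥ 0`. -/
theorem exists_hasContraction_delta_pE_mul (C : CartanDatum n) (i j : Fin n) (l : ℤ) :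
    ∃ c : ℕ → Kv, ∀ (y : PosFree n) (R : ℤ → PosFree n) (B m : ℤ) (N : ℕ),
      HasContraction (fun p => counit p.1) (delta C y) y →
      (∀ k, HasContraction (fun p => ePair C i k p.1) (delta C y) (R k)) →
      PairBound i (delta C y) B → m - N < B →
      HasContraction (fun p => ePair C i m p.1) (delta C (pE j l * y))
        ((if i = j ∧ m = l then y else 0) +
          ∑ t ∈ Finset.range N, c t • (pE j (l - t) * R (m - t))) := by
  choose c hc using exists_hasContraction_tmul_theta_mul C i j l
  refine ⟨c, fun y R B m N hε hR hB hN => ?_⟩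
  rw [map_mul, delta_pE, add_mul]
  refine .add ?_ ?_
  · rw [← one_mul (if i = j ∧ m = l then y else 0)]
    refine HasContraction.tmul_word_mul (u' := 1) ?_
    split_ifs with hij
    · refine hε.congr fun q => ?_
      rw [Prod.fst_mul, ePair_E_mul, if_pos hij]
      simp [twist, wt_one, CartanDatum.form]
    · refine .zero fun q => ?_
      rw [Prod.fst_mul, ePair_E_mul, if_neg hij, zero_mul, zero_mul]
  · have h1 : HasContraction (fun p => ePair C i m p.1)
        ((∑ t ∈ Finset.range N, CTensor.tmul C (theta j t) (pE j (l - t))) * delta C y)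
        (∑ t ∈ Finset.range N, c t • (pE j (l - t) * R (m - t))) := by
      rw [Finset.sum_mul]
      exact .sum _ fun t _ => hc t m _ _ (hR _)
    refine h1.congr fun p => ?_
    by_cases h0 : ePair C i m p.1 = 0
    · rw [h0, zero_mul, zero_mul]
    · rw [coeff_thetaE_mul j l _ N]
      intro t ht q r hq hqr
      exact hB.coeff_eq_zero (m := m) (by omega) hq (by rwa [hqr])

end Recursion

/-! ### The operators `F'_{i,m}` on the free algebra on the `E_{j,l}` -/

section Operators

variable {C : CartanDatum n}

/-- Words are built from the left because the Leibniz rule peels off the leftmost letter. -/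
theorem EFree.induction {P : PosFree n → Prop} (one : P 1)
    (pE_mul : ∀ j l y, y ∈ EFree n → P y → P (pE j l * y))
    (add : ∀ x y, x ∈ EFree n → y ∈ EFree n → P x → P y → P (x + y))
    (smul : ∀ (c : Kv) x, x ∈ EFree n → P x → P (c • x)) {x : PosFree n} (hx : x ∈ EFree n) :
    P x := by
  have hspan := Algebra.adjoin_eq_span Kv {x : PosFree n | ∃ i l, x = pE i l}
  have hmem : ∀ y, y ∈ Submodule.span Kv
      (Submonoid.closure {x : PosFree n | ∃ i l, x = pE i l} : Set (PosFree n)) ↔ y ∈ EFree n := by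
    intro y
    rw [← hspan]
    rfl
  refine Submodule.span_induction (p := fun y _ => P y) ?_ ?_ ?_ ?_ ((hmem x).2 hx)
  · intro y hy
    induction hy using Submonoid.closure_induction_left with
    | one => exact one
    | mul_left g hg y hy ih =>
      obtain ⟨j, l, rfl⟩ := hg
      exact pE_mul j l y ((hmem y).1 (Submodule.subset_span hy)) ih
  · simpa using smul 0 1 (one_mem _) one
  · exact fun y z hy hz => add y z ((hmem y).1 hy) ((hmem z).1 hz)
  · exact fun c y hy => smul c y ((hmem y).1 hy)

theorem hasContraction_one (ψ : Word n × Word n → Kv) :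
    HasContraction ψ (1 : CTensor C) (ψ 1 • 1) := by
  have h : ∀ p : Word n × Word n, p ≠ 1 →
      (ψ p * (1 : CTensor C).coeff p) • word p.2 = 0 := fun p hp => by
    rw [CTensor.coeff_one_of_ne hp, mul_zero, zero_smul]
  refine ⟨(Set.finite_singleton 1).subset fun p hp => ?_, ?_⟩
  · by_contra hc
    exact hp (h p hc)
  · rw [finsum_eq_single _ 1 h, CTensor.coeff_one_one, mul_one]
    rfl

/-- The counit axiom on the free algebra on the `E_{j,l}`. -/
theorem hasContraction_counit {x : PosFree n} (hx : x ∈ EFree n) :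
    HasContraction (fun p => counit p.1) (delta C x) x := by
  refine EFree.induction (P := fun x => HasContraction _ (delta C x) x) ?_ ?_ ?_ ?_ hx
  · have h := hasContraction_one (C := C) fun p => counit p.1
    rwa [Prod.fst_one, counit_one, one_smul, ← map_one (delta C)] at h
  · exact fun j l y _ hy => hy.counit_delta_pE_mul j l
  · intro x y _ _ hx hy
    rw [map_add]
    exact hx.add hy
  · intro c x _ hx
    rw [map_smul]
    exact hx.smul c

theorem exists_pairBound (i : Fin n) {x : PosFree n} (hx : x ∈ EFree n) :
    ∃ B, PairBound i (delta C x) B := by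
  refine EFree.induction (P := fun x => ∃ B, PairBound i (delta C x) B) ?_ ?_ ?_ ?_ hx
  · refine ⟨0, fun m _ p => ?_⟩
    rw [map_one]
    by_cases hp : p = 1
    · rw [hp, Prod.fst_one, ePair_one, zero_mul]
    · rw [CTensor.coeff_one_of_ne hp, mul_zero]
  · rintro j l y _ ⟨B, hB⟩
    exact ⟨min B l, (hB.mono (min_le_left _ _)).delta_pE_mul (min_le_right _ _)⟩
  · rintro x y _ _ ⟨B, hB⟩ ⟨B', hB'⟩
    refine ⟨min B B', fun m hm p => ?_⟩
    rw [map_add, CTensor.coeff_add, mul_add, hB m (hm.trans_le (min_le_left _ _)),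
      hB' m (hm.trans_le (min_le_right _ _)), add_zero]
  · rintro c x _ ⟨B, hB⟩
    refine ⟨B, fun m hm p => ?_⟩
    rw [map_smul, CTensor.coeff_smul, mul_left_comm, hB m hm, mul_zero]

/-- A `finsum` of infinite support is $0$ by default, so identities for $F'_{i,m}$ are obtained
through contractions, which carry finiteness. -/
theorem Fprime_eq_of_hasContraction {i : Fin n} {m : ℤ} {x r : PosFree n}
    (h : HasContraction (fun p => ePair C i m p.1) (delta C x) r) : Fprime C i m x = r := by
  rw [← h.2, Fprime]
  exact finsum_congr fun p => by simp only [ePair, mul_assoc]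

/-- The sum defining `F'_{i,m}(x)` is finite. -/
theorem hasContraction_Fprime (i : Fin n) (m : ℤ) {x : PosFree n} (hx : x ∈ EFree n) :
    HasContraction (fun p => ePair C i m p.1) (delta C x) (Fprime C i m x) := by
  suffices h : ∀ m, ∃ r, HasContraction (fun p => ePair C i m p.1) (delta C x) r by
    obtain ⟨r, hr⟩ := h m
    rwa [Fprime_eq_of_hasContraction hr]
  refine EFree.induction
    (P := fun x => ∀ m, ∃ r, HasContraction (fun p => ePair C i m p.1) (delta C x) r)
    ?_ ?_ ?_ ?_ hx
  · intro m
    rw [map_one]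
    exact ⟨_, hasContraction_one _⟩
  · intro j l y hy ih m
    choose R hR using ih
    obtain ⟨c, hc⟩ := exists_hasContraction_delta_pE_mul C i j l
    obtain ⟨B, hB⟩ := exists_pairBound (C := C) i hy
    -- This truncation guarantees $m-N<B$.
    exact ⟨_, hc y R B m (m - B + 1).toNat (hasContraction_counit hy) hR hB (by omega)⟩
  · intro x y _ _ hx hy m
    obtain ⟨r, hr⟩ := hx m
    obtain ⟨s, hs⟩ := hy m
    rw [map_add]
    exact ⟨_, hr.add hs⟩
  · intro c x _ hx m
    obtain ⟨r, hr⟩ := hx m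
    rw [map_smul]
    exact ⟨_, hr.smul c⟩

theorem Fprime_one (i : Fin n) (m : ℤ) : Fprime C i m 1 = 0 := by
  have h := hasContraction_one (C := C) fun p => ePair C i m p.1
  rw [Prod.fst_one, ePair_one, zero_smul, ← map_one (delta C)] at h
  exact Fprime_eq_of_hasContraction h

theorem Fprime_add (i : Fin n) (m : ℤ) {x y : PosFree n} (hx : x ∈ EFree n) (hy : y ∈ EFree n) :
    Fprime C i m (x + y) = Fprime C i m x + Fprime C i m y := by
  apply Fprime_eq_of_hasContraction
  rw [map_add]
  exact (hasContraction_Fprime i m hx).add (hasContraction_Fprime i m hy)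

theorem Fprime_smul (i : Fin n) (m : ℤ) (c : Kv) {x : PosFree n} (hx : x ∈ EFree n) :
    Fprime C i m (c • x) = c • Fprime C i m x := by
  apply Fprime_eq_of_hasContraction
  rw [map_smul]
  exact (hasContraction_Fprime i m hx).smul c

/-- `F'_{i,m}(E_{j,l} y) = δ_{i,j} δ_{m,l} y + ∑_{t ≥ 0} c_t E_{j,l-t} F'_{i,m-t}(y)`, where all but
finitely many summands vanish. -/
theorem Fprime_pE_mul (C : CartanDatum n) (i j : Fin n) (l : ℤ) :
    ∃ c : ℕ → Kv, ∀ y ∈ EFree n, ∀ m : ℤ, ∃ N₀ : ℕ, ∀ N ≥ N₀,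
      Fprime C i m (pE j l * y) = (if i = j ∧ m = l then y else 0) +
        ∑ t ∈ Finset.range N, c t • (pE j (l - t) * Fprime C i (m - t) y) := by
  obtain ⟨c, hc⟩ := exists_hasContraction_delta_pE_mul C i j l
  refine ⟨c, fun y hy m => ?_⟩
  obtain ⟨B, hB⟩ := exists_pairBound (C := C) i hy
  refine ⟨(m - B + 1).toNat, fun N hN => Fprime_eq_of_hasContraction ?_⟩
  exact hc y (fun k => Fprime C i k y) B m N (hasContraction_counit hy)
    (fun k => hasContraction_Fprime i k hy) hB (by omega)

end Operators

/-! ### The common kernel is a subalgebra -/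

section Kernel

variable {C : CartanDatum n} {𝔥 : Type*} [AddCommGroup 𝔥] [Module ℂ 𝔥]

/-- If the `F'_{i,m}(y)` with `m ≤ k` vanish in `U_v(L𝔤)`, then `F'_{i,m}(x y) = F'_{i,m}(x) y` there
for `m ≤ k`. -/
theorem proj_Fprime_mul (ρ : Realization C 𝔥) (i : Fin n) (k : ℤ) {x y : PosFree n}
    (hx : x ∈ EFree n) (hy : y ∈ EFree n) (h : ∀ m ≤ k, proj ρ (Fprime C i m y) = 0) :
    ∀ m ≤ k, proj ρ (Fprime C i m (x * y)) = proj ρ (Fprime C i m x) * proj ρ y := by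
  refine EFree.induction
    (P := fun x => ∀ m ≤ k, proj ρ (Fprime C i m (x * y)) = proj ρ (Fprime C i m x) * proj ρ y)
    ?_ ?_ ?_ ?_ hx
  · intro m hm
    rw [one_mul, h m hm, Fprime_one, map_zero, zero_mul]
  · intro j l x hx ih m hm
    obtain ⟨c, hc⟩ := Fprime_pE_mul C i j l
    obtain ⟨N₁, h₁⟩ := hc x hx m
    obtain ⟨N₂, h₂⟩ := hc (x * y) (mul_mem hx hy) m
    -- Both expansions have the same coefficients $c_t$; cutting both at the larger threshold makes
    -- them match termwise, and $m-t\le k$ lets the induction hypothesis apply.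
    rw [mul_assoc, h₁ _ (le_max_left N₁ N₂), h₂ _ (le_max_right N₁ N₂), map_add, map_add, add_mul,
      map_sum, map_sum, Finset.sum_mul]
    congr 1
    · split_ifs
      · rw [map_mul]
      · rw [map_zero, zero_mul]
    · refine Finset.sum_congr rfl fun t _ => ?_
      rw [map_smul, map_smul, map_mul, map_mul, ih _ (by omega), smul_mul_assoc, mul_assoc]
  · intro x x' hx hx' ih ih' m hm
    rw [add_mul, Fprime_add i m (mul_mem hx hy) (mul_mem hx' hy), Fprime_add i m hx hx', map_add,
      map_add, ih m hm, ih' m hm, add_mul]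
  · intro c x hx ih m hm
    rw [smul_mul_assoc, Fprime_smul i m c (mul_mem hx hy), Fprime_smul i m c hx, map_smul, map_smul,
      ih m hm, smul_mul_assoc]

/-- The common kernel `Z'_{i,k}` as a subalgebra of `U_v(L𝔫)`. -/
def zprimeSubalgebra (ρ : Realization C 𝔥) (i : Fin n) (k : ℤ) : Subalgebra Kv (Un ρ) where
  carrier := Zprime ρ i k
  mul_mem' := by
    rintro u w ⟨x, hx, hxu, hx0⟩ ⟨y, hy, hyw, hy0⟩
    refine ⟨x * y, mul_mem hx hy, ?_, fun m hm => ?_⟩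
    · rw [map_mul, hxu, hyw, Subalgebra.coe_mul]
    · rw [proj_Fprime_mul ρ i k hx hy hy0 m hm, hx0 m hm, zero_mul]
  add_mem' := by
    rintro u w ⟨x, hx, hxu, hx0⟩ ⟨y, hy, hyw, hy0⟩
    refine ⟨x + y, add_mem hx hy, ?_, fun m hm => ?_⟩
    · rw [map_add, hxu, hyw, Subalgebra.coe_add]
    · rw [Fprime_add i m hx hy, map_add, hx0 m hm, hy0 m hm, add_zero]
  algebraMap_mem' := by
    intro c
    refine ⟨c • 1, Subalgebra.smul_mem _ (one_mem _) c, ?_, fun m _ => ?_⟩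
    · rw [map_smul, map_one, Algebra.algebraMap_eq_smul_one, Subalgebra.coe_smul,
        Subalgebra.coe_one]
    · rw [Fprime_smul i m c (one_mem _), Fprime_one, smul_zero, map_zero]

theorem map_proj_EFree (ρ : Realization C 𝔥) : (EFree n).map (proj ρ) = Un ρ := by
  have h : ∀ i l, proj ρ (pE i l) = uE ρ i l := fun i l => by
    rw [proj, pE, word, MonoidAlgebra.lift_single, one_smul, FreeMonoid.lift_eval_of]
  rw [EFree, Un, AlgHom.map_adjoin]
  congr 1
  ext x
  constructor
  · rintro ⟨_, ⟨i, l, rfl⟩, rfl⟩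
    exact ⟨i, l, h i l⟩
  · rintro ⟨i, l, rfl⟩
    exact ⟨_, ⟨i, l, rfl⟩, h i l⟩

/-- Every $u$ has an expression in the $E_{j,l}$ since $\pi(T_E)=U_v(\mathcal L\mathfrak n)$, and
`IsFprime` evaluates $F'_{i,m}(u)$ on any expression, so vanishing on one of them is the same as $u$
lying in the kernel. -/
theorem IsFprime.iInter_ker_eq {ρ : Realization C 𝔥} {i : Fin n} {F : ℤ → Module.End Kv (Un ρ)}
    (hF : IsFprime ρ i F) (k : ℤ) : ⋂ m ≤ k, {u | F m u = 0} = Zprime ρ i k := by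
  ext u
  simp only [Set.mem_iInter, Set.mem_ofPred_eq]
  constructor
  · intro hu
    obtain ⟨x, hx, hxu⟩ : ∃ x ∈ EFree n, proj ρ x = u :=
      (map_proj_EFree ρ).ge u.2
    refine ⟨x, hx, hxu, fun m hm => ?_⟩
    rw [← hF x hx u hxu.symm m, hu m hm, Subalgebra.coe_zero]
  · rintro ⟨x, hx, hxu, h0⟩ m hm
    apply Subtype.ext
    rw [hF x hx u hxu.symm m, h0 m hm, Subalgebra.coe_zero]

end Kernel

end QLoop

theorem mainTheorem3 {n : ℕ} (C : QLoop.CartanDatum n)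
    {𝔥 : Type*} [AddCommGroup 𝔥] [Module ℂ 𝔥] (ρ : QLoop.Realization C 𝔥)
    (i : Fin n) (k : ℤ) :
    (∃ S : Subalgebra QLoop.Kv (QLoop.Un ρ), (S : Set (QLoop.Un ρ)) = QLoop.Zprime ρ i k) ∧
    (∀ F : ℤ → Module.End QLoop.Kv (QLoop.Un ρ), QLoop.IsFprime ρ i F →
      ∃ S : Subalgebra QLoop.Kv (QLoop.Un ρ),
        (S : Set (QLoop.Un ρ)) = ⋂ m ≤ k, {u | F m u = 0}) :=
  ⟨⟨QLoop.zprimeSubalgebra ρ i k, rfl⟩, fun _ hF =>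
    ⟨QLoop.zprimeSubalgebra ρ i k, (hF.iInter_ker_eq k).symm⟩⟩
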